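/- Consider a shared link network with $n$ users, $m$ files, cache capacity $M>0$ (in files), and i.i.d. user requests with a non-increasing probability mass function $\mathbf q=(q_1,\dots,q_m)$. Fix an integer cut-off index $\widetilde m$ with $M\le\widetilde m\le m$. Each file of $F$ bits is divided into $B=B(F)$ packets, where $B(F)\to\infty$ as $F\to\infty$ (for instance $F/B$ tending to a constant). RLFU placement: independently for all users and all files $f\le\widetilde m$, user $u$ caches a uniformly chosen set $\mathsf C_{u,f}$ of $\lfloor MB/\widetilde m\rfloor$ distinct packets of file $f$; nothing is cached from the files $f>\widetilde m$. GCC delivery: given the caches $\mathbf C$ and the requests $(f_1,\dots,f_n)$, the conflict graph has a vertex $v$ for each pair of a user $\mu(v)$ and a packet $\rho(v)$ of file $f_{\mu(v)}$ that $\mu(v)$ has not cached; let $\eta(v)$ be the set of all users caching $\rho(v)$. Vertices $v,w$ are adjacent iff $\rho(v)\ne\rho(w)$ and ($\mu(v)\notin\eta(w)$ or $\mu(w)\notin\eta(v)$). GCC$_1$ repeatedly picks any uncolored vertex $v$, sets $I=\{v\}$, runs in any order through the other uncolored vertices $v'$, adding $v'$ to $I$ if $v'$ has no neighbor in $I$ and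 $\{\mu(v')\}\cup\eta(v')=\{\mu(v)\}\cup\eta(v)$, and then gives all of $I$ a new color, until all vertices are colored. GCC$_2$ does the same with the condition $\rho(v')=\rho(v)$ for adding $v'$. GCC uses whichever of the two colorings has fewer colors. The (random) conditional rate is $$R^{\rm GCC}(n,m,M,\mathbf q,\widetilde{\mathbf p})=\frac{1}{B}\,\mathbb E\big[\text{number of colors produced by GCC}\,\big|\,\mathsf C\big],$$ where $\widetilde{\mathbf p}$ is given by $\widetilde p_f=1/\widetilde m$ for $f\le\widetilde m$ and $\widetilde p_f=0$ otherwise, the requests are independent of the caches, and the expectation is over the requests. Then, for any $\epsilon>0$ and however the arbitrary choices in GCC are made, $$\lim_{F\to\infty}\mathbb P\Big(R^{\rm GCC}(n,m,M,\mathbf q,\widetilde{\mathbf p})\le\min\{\widetilde\psi(\mathbf q,\widetilde m),\bar m\}+\epsilon\Big)=1,$$ where $$\widetilde\psi(\mathbf q,\widetilde m)=\Big(\frac{\widetilde m}{M}-1\Big)\Big(1-\Big(1-\frac{M}{\widetilde m}\Big)^{nG_{\widetilde m}}\Big)+n(1-G_{\widetilde m}),\qquad G_{\widetilde m}=\sum_{f=1}^{\widetilde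 m}q_f,\qquad \bar m=\sum_{f=1}^m\big(1-(1-q_f)^n\big).$$ -/

import Mathlib

open Filter Topology MeasureTheory

namespace Caching

/-! ### Cache configurations, demands and the conflict graph

Users are `Fin n`, files are `Fin m` (file `f` of the usual numbering `1, …, m` is the element of
value `f - 1`), and every file consists of `B` packets, indexed by `Fin B`. -/

/-- A cache configuration: `C u f` is the set of (indices of) packets of file `f` cached by `u`. -/
abbrev Placement (n m B : ℕ) : Type := Fin n → Fin m → Finset (Fin B)

/-- A demand vector: `d u` is the file requested by user `u`. -/
abbrev Demand (n m : ℕ) : Type := Fin n → Fin m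

/-- Vertex labels (packet identity, user requesting, users caching); a packet identity is a pair
(file index, packet index). -/
abbrev Label (n m B : ℕ) : Type := (Fin m × Fin B) × Fin n × Finset (Fin n)

variable {n m B : ℕ}

/-- The packet identity of a label. -/
def Label.packet (v : Label n m B) : Fin m × Fin B := v.1

/-- The user requesting the packet. -/
def Label.requester (v : Label n m B) : Fin n := v.2.1

/-- The set of all users caching the packet. -/
def Label.cachers (v : Label n m B) : Finset (Fin n) := v.2.2

/-- The set of the users either requesting or caching the packet of `v`. -/
def Label.users (v : Label n m B) : Finset (Fin n) := insert v.requester v.cachers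

/-- The packets that user `u` needs, under the cache configuration `C` and the demand `d`: the
packets of the requested file that `u` has not cached. -/
def packetDemand (C : Placement n m B) (d : Demand n m) (u : Fin n) : Finset (Fin m × Fin B) :=
  Finset.univ.filter fun r => r.1 = d u ∧ r.2 ∉ C u r.1

/-- The vertices of the conflict graph: all labels `(r, u, A)` such that `u` needs the packet `r`
and `A` is the set of all users that cache `r`. -/
def conflictVertices (C : Placement n m B) (d : Demand n m) : Finset (Label n m B) :=
  Finset.univ.filter fun v =>
    v.packet ∈ packetDemand C d v.requester ∧
      v.cachers = Finset.univ.filter fun u => v.packet.2 ∈ C u v.packet.1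

/-- The adjacency of the conflict graph: the packets differ, and at least one of the two
requesting users has not cached the packet requested by the other one. The conflict graph of
`(C, d)` is the restriction of this graph to `conflictVertices C d`. -/
def conflictGraph (n m B : ℕ) : SimpleGraph (Label n m B) where
  Adj v w := v.packet ≠ w.packet ∧ (v.requester ∉ w.cachers ∨ w.requester ∉ v.cachers)
  symm := ⟨fun _ _ h => ⟨h.1.symm, h.2.symm⟩⟩
  loopless := ⟨fun _ h => h.1 rfl⟩

instance : DecidableRel (conflictGraph n m B).Adj := fun v w =>
  inferInstanceAs
    (Decidable (v.packet ≠ w.packet ∧ (v.requester ∉ w.cachers ∨ w.requester ∉ v.cachers)))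

/-! ### Greedy constrained coloring -/

/-- The inner loop of the first algorithm, with root `v`: run through the list `l`, starting with
the current set `I`, and add `v'` to the set if it has no edge to the set and if it has the same
set of users requesting or caching as `v`. -/
def gcc1Loop (v : Label n m B) : List (Label n m B) → Finset (Label n m B) → Finset (Label n m B)
  | [], I => I
  | v' :: l, I =>
      gcc1Loop v l
        (if (∀ w ∈ I, ¬ (conflictGraph n m B).Adj v' w) ∧ v'.users = v.users
          then insert v' I else I)

/-- The inner loop of the second algorithm, with root `v`: add `v'` to the set if it is
associated to the same packet as `v`. -/
def gcc2Loop (v : Label n m B) : List (Label n m B) → Finset (Label n m B) → Finset (Label n m B)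
  | [], I => I
  | v' :: l, I => gcc2Loop v l (if v'.packet = v.packet then insert v' I else I)

/-- The outer loop: `Run loop V cs` says that the algorithm with inner loop `loop`, started with
the set `V` of uncolored vertices, can produce the list `cs` of color classes. In each round the
root `v ∈ V` is arbitrary, and so is the order `l` in which the inner loop runs through the other
vertices of `V`. -/
inductive Run
    (loop : Label n m B → List (Label n m B) → Finset (Label n m B) → Finset (Label n m B)) :
    Finset (Label n m B) → List (Finset (Label n m B)) → Prop
  | done : Run loop ∅ []
  | step {V : Finset (Label n m B)} {v : Label n m B} {l : List (Label n m B)}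
      {cs : List (Finset (Label n m B))}
      (hv : v ∈ V) (hnodup : l.Nodup) (hl : ∀ w, w ∈ l ↔ w ∈ V ∧ w ≠ v)
      (hrun : Run loop (V \ loop v l {v}) cs) : Run loop V (loop v l {v} :: cs)

/-- `IsGCCColorCount C d N`: in the delivery for the caches `C` and the demand `d`, the greedy
constrained coloring can output a coloring with `N` colors, the smaller of the two numbers of
colors produced by the two algorithms. -/
def IsGCCColorCount (C : Placement n m B) (d : Demand n m) (N : ℕ) : Prop :=
  ∃ cs₁ cs₂ : List (Finset (Label n m B)),
    Run gcc1Loop (conflictVertices C d) cs₁ ∧ Run gcc2Loop (conflictVertices C d) cs₂ ∧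
      N = min cs₁.length cs₂.length

/-- The conditional rate given the caches `C`, i.e. the conditional expectation given `C` of the
number of colors, normalized by `B`, when the delivery uses `N C d` colors for the demand `d` and
the requests of the users are i.i.d. with probability mass function `q`, independently of `C`. -/
noncomputable def conditionalRate (q : Fin m → ℝ) (N : Placement n m B → Demand n m → ℕ)
    (C : Placement n m B) : ℝ :=
  (∑ d : Demand n m, (∏ u, q (d u)) * (N C d : ℝ)) / B

/-! ### Random fractional placement -/

/-- The law of the random caches for the caching distribution `p` and the cache capacity `M`:
independently over all users and all files, a uniformly distributed set of `p f * M * B` distinct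
packets of the file `f` (rounded down where this is not an integer). -/
noncomputable def placementLaw (n B : ℕ) (M : ℝ) (p : Fin m → ℝ) : Measure (Placement n m B) :=
  Measure.pi fun _ : Fin n => Measure.pi fun f : Fin m =>
    ProbabilityTheory.uniformOn {S : Finset (Fin B) | S.card = ⌊p f * M * B⌋₊}

/-- The truncated uniform caching distribution with cut-off index `k`. -/
noncomputable def truncatedUniform (m k : ℕ) (f : Fin m) : ℝ :=
  if (f : ℕ) < k then 1 / (k : ℝ) else 0

/-! ### The quantities of the bound -/

/-- The total popularity of the first `k` files. -/
noncomputable def headMass (q : Fin m → ℝ) (k : ℕ) : ℝ :=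
  ∑ f : Fin m, if (f : ℕ) < k then q f else 0

/-- The average number of distinct requested files. -/
noncomputable def mBar (n : ℕ) (q : Fin m → ℝ) : ℝ :=
  ∑ f : Fin m, (1 - (1 - q f) ^ n)

/-- The first term of the bound; `k` is the cut-off index. -/
noncomputable def psiTilde (n : ℕ) (M : ℝ) (q : Fin m → ℝ) (k : ℕ) : ℝ :=
  ((k : ℝ) / M - 1) * (1 - (1 - M / (k : ℝ)) ^ ((n : ℝ) * headMass q k))
    + (n : ℝ) * (1 - headMass q k)

/-! ### The greedy constrained coloring always has an output -/

theorem mem_gcc1Loop (v : Label n m B) (l : List (Label n m B)) (I : Finset (Label n m B))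
    {w : Label n m B} (hw : w ∈ I) : w ∈ gcc1Loop v l I := by
  induction l generalizing I with
  | nil => exact hw
  | cons a l ih =>
    rw [gcc1Loop]
    apply ih
    split_ifs
    · exact Finset.mem_insert_of_mem hw
    · exact hw

theorem mem_gcc2Loop (v : Label n m B) (l : List (Label n m B)) (I : Finset (Label n m B))
    {w : Label n m B} (hw : w ∈ I) : w ∈ gcc2Loop v l I := by
  induction l generalizing I with
  | nil => exact hw
  | cons a l ih =>
    rw [gcc2Loop]
    apply ih
    split_ifs
    · exact Finset.mem_insert_of_mem hw
    · exact hw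

theorem exists_run
    (loop : Label n m B → List (Label n m B) → Finset (Label n m B) → Finset (Label n m B))
    (hloop : ∀ v l, v ∈ loop v l {v}) (V : Finset (Label n m B)) : ∃ cs, Run loop V cs := by
  induction V using Finset.strongInduction with
  | H V ih =>
    rcases V.eq_empty_or_nonempty with rfl | ⟨v, hv⟩
    · exact ⟨[], Run.done⟩
    · have hlt : V \ loop v (V.erase v).toList {v} ⊂ V :=
        (Finset.ssubset_iff_of_subset Finset.sdiff_subset).2
          ⟨v, hv, fun h => (Finset.mem_sdiff.1 h).2 (hloop _ _)⟩
      obtain ⟨cs, hcs⟩ := ih _ hlt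
      exact ⟨_, Run.step hv (Finset.nodup_toList _)
        (fun w => by rw [Finset.mem_toList, Finset.mem_erase, and_comm]) hcs⟩

theorem exists_isGCCColorCount (C : Placement n m B) (d : Demand n m) :
    ∃ N, IsGCCColorCount C d N := by
  obtain ⟨cs₁, h₁⟩ := exists_run gcc1Loop
    (fun v l => mem_gcc1Loop v l _ (Finset.mem_singleton_self v)) (conflictVertices C d)
  obtain ⟨cs₂, h₂⟩ := exists_run gcc2Loop
    (fun v l => mem_gcc2Loop v l _ (Finset.mem_singleton_self v)) (conflictVertices C d)
  exact ⟨_, cs₁, cs₂, h₁, h₂, rfl⟩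

end Caching

/-! For fixed caches, every color class of the first algorithm consists of vertices with one common
set `S` of requesting or caching users, and a round of type `S` removes a vertex of every user that
still has one of type `S`. So type `S` costs at most the largest number of such vertices that one
user `u` has, and these are packets of the file requested by `u` that are cached by exactly `S.erase
u` (`length_le_of_run_gcc1Loop`, `card_userClass_conflictVertices_le`).

A second-moment estimate (`tendsto_placementLaw_abs_sub_le`) shows that with probability tending to
one the fraction of packets cached by exactly `T` is close to `x ^ |T| * (1 - x) ^ (n - |T|)`, where
`x` is `M / k` for the first `k` files and `0` for the others. If `H` is the set of users with a
request among the first `k` files, summing over `S` gives `(1 / x - 1) * (1 - (1 - x) ^ |H|) + (n -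
|H|)` with `x = M / k` (`sum_colorDensity`). Under random requests `|H|` is binomial, and
Bernoulli's inequality bounds the mean by `psiTilde`.

The second algorithm never needs more than `B` colors per distinct requested file, which gives
`mBar` for all caches. -/

namespace Caching

/-! ### Deterministic bounds on the number of colors. -/

section Coloring

variable {n m B : ℕ}

/-- The vertices of `V` with requester `u` and set of requesting or caching users `S`. -/
def userClass (V : Finset (Label n m B)) (S : Finset (Fin n)) (u : Fin n) :
    Finset (Label n m B) :=
  V.filter fun v => v.requester = u ∧ v.users = S

/-- Two vertices with the same user set and different requesters are not adjacent: each requester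
lies in the common set, hence among the cachers of the other vertex. So when the loop reaches `w`,
only a vertex with the same requester can keep it out. -/
theorem exists_mem_gcc1Loop {v : Label n m B} (l : List (Label n m B)) (I : Finset (Label n m B))
    {w : Label n m B} (hI : ∀ x ∈ I, x.users = v.users) (hw : w ∈ l) (hwu : w.users = v.users) :
    ∃ x ∈ gcc1Loop v l I, (x ∈ I ∨ x ∈ l) ∧ x.users = v.users ∧ x.requester = w.requester := by
  induction l generalizing I with
  | nil => simp at hw
  | cons a l ih =>
    rw [gcc1Loop]
    by_cases hx : ∃ x ∈ I, x.requester = w.requester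
    · obtain ⟨x, hxI, hxw⟩ := hx
      refine ⟨x, mem_gcc1Loop _ _ _ ?_, Or.inl hxI, hI x hxI, hxw⟩
      split_ifs
      · exact Finset.mem_insert_of_mem hxI
      · exact hxI
    push Not at hx
    rcases List.mem_cons.1 hw with rfl | hwl
    · refine ⟨w, mem_gcc1Loop _ _ _ ?_, Or.inr hw, hwu, rfl⟩
      rw [if_pos]
      · exact Finset.mem_insert_self _ _
      · refine ⟨fun x hxI hadj => ?_, hwu⟩
        have hu : w.users = x.users := hwu.trans (hI x hxI).symm
        have h1 : w.requester ∈ x.users := hu ▸ Finset.mem_insert_self _ _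
        have h2 : x.requester ∈ w.users := hu ▸ Finset.mem_insert_self _ _
        rcases hadj.2 with h | h
        · exact (Finset.mem_insert.1 h1).elim (fun e => hx x hxI e.symm) h
        · exact (Finset.mem_insert.1 h2).elim (hx x hxI) h
    · obtain ⟨x, hx1, hx2, hx3⟩ := ih (if (∀ w ∈ I, ¬ (conflictGraph n m B).Adj a w) ∧
          a.users = v.users then insert a I else I) (by
        intro x hxI
        split_ifs at hxI with h
        · rcases Finset.mem_insert.1 hxI with rfl | h'
          · exact h.2
          · exact hI x h'
        · exact hI x hxI) hwl
      refine ⟨x, hx1, ?_, hx3⟩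
      rcases hx2 with hx2 | hx2
      · split_ifs at hx2
        · rcases Finset.mem_insert.1 hx2 with rfl | h'
          · exact Or.inr List.mem_cons_self
          · exact Or.inl h'
        · exact Or.inl hx2
      · exact Or.inr (List.mem_cons_of_mem _ hx2)

/-- The number of colors of the first algorithm is at most the sum over all sets of users `S` of
the largest number of vertices of type `S` requested by a single user. -/
theorem length_le_of_run_gcc1Loop {V : Finset (Label n m B)} {cs : List (Finset (Label n m B))}
    (h : Run gcc1Loop V cs) :
    cs.length ≤ ∑ S : Finset (Fin n), Finset.univ.sup fun u => (userClass V S u).card := by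
  induction h with
  | done => simp
  | @step V v l cs hv hnodup hl hrun ih =>
    have hsub : V \ gcc1Loop v l {v} ⊆ V := Finset.sdiff_subset
    rw [List.length_cons, Nat.succ_le_iff]
    -- The sum serves as a potential: a round increases no term, and it strictly decreases the term
    -- of `v.users`, since each user with a vertex of that type loses one.
    refine ih.trans_lt (Finset.sum_lt_sum (fun S _ => ?_) ⟨v.users, Finset.mem_univ _, ?_⟩)
    · exact Finset.sup_mono_fun fun u _ =>
        Finset.card_le_card (Finset.filter_subset_filter _ hsub)
    · have hpos : 0 < Finset.univ.sup fun u => (userClass V v.users u).card := by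
        refine lt_of_lt_of_le ?_
          (Finset.le_sup (f := fun u => (userClass V v.users u).card)
            (Finset.mem_univ v.requester))
        exact Finset.card_pos.2 ⟨v, Finset.mem_filter.2 ⟨hv, rfl, rfl⟩⟩
      rw [Finset.sup_lt_iff hpos]
      intro u _
      have hle : userClass (V \ gcc1Loop v l {v}) v.users u ⊆ userClass V v.users u :=
        Finset.filter_subset_filter _ hsub
      rcases (userClass V v.users u).eq_empty_or_nonempty with he | ⟨w, hw⟩
      · rw [he] at hle
        rw [Finset.subset_empty.1 hle]
        exact hpos
      · refine lt_of_lt_of_le (Finset.card_lt_card ((Finset.ssubset_iff_of_subset hle).2 ?_))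
          (Finset.le_sup (f := fun u => (userClass V v.users u).card) (Finset.mem_univ u))
        obtain ⟨hwV, hwu, hwS⟩ := Finset.mem_filter.1 hw
        obtain ⟨x, hxI, hxV, hxS, hxu⟩ : ∃ x ∈ gcc1Loop v l {v}, x ∈ V ∧ x.users = v.users ∧
            x.requester = w.requester := by
          by_cases hwv : w = v
          · exact ⟨v, mem_gcc1Loop _ _ _ (Finset.mem_singleton_self v), hv, rfl, by rw [hwv]⟩
          · obtain ⟨x, h1, h2, h3⟩ := exists_mem_gcc1Loop (v := v) l {v}
              (by simp) ((hl w).2 ⟨hwV, hwv⟩) hwS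
            refine ⟨x, h1, ?_, h3⟩
            rcases h2 with h2 | h2
            · rw [Finset.mem_singleton.1 h2]; exact hv
            · exact ((hl x).1 h2).1
        exact ⟨x, Finset.mem_filter.2 ⟨hxV, hxu.trans hwu, hxS⟩,
          fun h => (Finset.mem_sdiff.1 (Finset.mem_filter.1 h).1).2 hxI⟩

theorem mem_gcc2Loop_of_packet_eq {v : Label n m B} (l : List (Label n m B))
    (I : Finset (Label n m B)) {w : Label n m B} (hw : w ∈ l) (hwp : w.packet = v.packet) :
    w ∈ gcc2Loop v l I := by
  induction l generalizing I with
  | nil => simp at hw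
  | cons a l ih =>
    rw [gcc2Loop]
    rcases List.mem_cons.1 hw with rfl | h
    · rw [if_pos hwp]
      exact mem_gcc2Loop _ _ _ (Finset.mem_insert_self _ _)
    · exact ih _ h

/-- The number of colors of the second algorithm is at most the number of distinct packets. -/
theorem length_le_of_run_gcc2Loop {V : Finset (Label n m B)} {cs : List (Finset (Label n m B))}
    (h : Run gcc2Loop V cs) : cs.length ≤ (V.image Label.packet).card := by
  induction h with
  | done => simp
  | @step V v l cs hv hnodup hl hrun ih =>
    rw [List.length_cons, Nat.succ_le_iff]
    refine ih.trans_lt (Finset.card_lt_card ((Finset.ssubset_iff_of_subset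
      (Finset.image_subset_image Finset.sdiff_subset)).2
      ⟨v.packet, Finset.mem_image_of_mem _ hv, fun hmem => ?_⟩))
    obtain ⟨w, hw, hwp⟩ := Finset.mem_image.1 hmem
    obtain ⟨hwV, hwI⟩ := Finset.mem_sdiff.1 hw
    by_cases hwv : w = v
    · exact hwI (by rw [hwv]; exact mem_gcc2Loop _ _ _ (Finset.mem_singleton_self v))
    · exact hwI (mem_gcc2Loop_of_packet_eq l {v} ((hl w).2 ⟨hwV, hwv⟩) hwp)

/-- The packets of the file `f` that are cached by exactly the users in `T`. -/
def exactlyCached (C : Placement n m B) (f : Fin m) (T : Finset (Fin n)) : Finset (Fin B) :=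
  Finset.univ.filter fun j => (Finset.univ.filter fun u => j ∈ C u f) = T

/-- A requester never caches the packet it needs, so the cachers are exactly `S.erase u`. The file
being `d u`, the packet index then determines the vertex. -/
theorem card_userClass_conflictVertices_le (C : Placement n m B) (d : Demand n m)
    (S : Finset (Fin n)) (u : Fin n) :
    (userClass (conflictVertices C d) S u).card ≤ (exactlyCached C (d u) (S.erase u)).card := by
  have key : ∀ v ∈ userClass (conflictVertices C d) S u,
      v.requester = u ∧ v.packet.1 = d u ∧ v.cachers = S.erase u ∧
        v.cachers = Finset.univ.filter fun w => v.packet.2 ∈ C w (d u) := by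
    intro v hv
    obtain ⟨hvV, hvu, hvS⟩ := Finset.mem_filter.1 hv
    obtain ⟨h1, h2⟩ := (Finset.mem_filter.1 hvV).2
    obtain ⟨h3, h4⟩ := (Finset.mem_filter.1 h1).2
    rw [hvu] at h3 h4
    rw [h3] at h2 h4
    refine ⟨hvu, h3, ?_, h2⟩
    rw [← hvS, Label.users, hvu, Finset.erase_insert]
    rw [h2]
    simpa using h4
  refine Finset.card_le_card_of_injOn (fun v => v.packet.2) (fun v hv => ?_) ?_
  · obtain ⟨-, -, h3, h4⟩ := key v hv
    exact Finset.mem_filter.2 ⟨Finset.mem_univ _, h4.symm.trans h3⟩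
  · intro v hv w hw hvw
    obtain ⟨a1, a2, a3, -⟩ := key v hv
    obtain ⟨b1, b2, b3, -⟩ := key w hw
    exact Prod.ext (Prod.ext (a2.trans b2.symm) hvw)
      (Prod.ext (a1.trans b1.symm) (a3.trans b3.symm))

theorem userClass_eq_empty (V : Finset (Label n m B)) {S : Finset (Fin n)} {u : Fin n}
    (hu : u ∉ S) : userClass V S u = ∅ := by
  refine Finset.filter_eq_empty_iff.2 fun v _ h => hu ?_
  rw [← h.1, ← h.2]
  exact Finset.mem_insert_self _ _

theorem length_le_sum_of_run_gcc1Loop {C : Placement n m B} {d : Demand n m}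
    {cs : List (Finset (Label n m B))} (h : Run gcc1Loop (conflictVertices C d) cs)
    (b : Finset (Fin n) → ℝ) (hb0 : ∀ S, 0 ≤ b S)
    (hb : ∀ S, ∀ u ∈ S, ((exactlyCached C (d u) (S.erase u)).card : ℝ) ≤ b S) :
    (cs.length : ℝ) ≤ ∑ S, b S := by
  refine (Nat.cast_le.2 (length_le_of_run_gcc1Loop h)).trans ?_
  rw [Nat.cast_sum]
  refine Finset.sum_le_sum fun S _ => ?_
  -- The supremum lives in `ℕ`, so the real bound is replaced by its floor.
  rw [← Nat.le_floor_iff (hb0 S)]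
  refine Finset.sup_le fun u _ => ?_
  by_cases hu : u ∈ S
  · exact Nat.le_floor
      ((Nat.cast_le.2 (card_userClass_conflictVertices_le C d S u)).trans (hb S u hu))
  · rw [userClass_eq_empty _ hu]
    exact Nat.zero_le _

theorem length_le_of_run_gcc2Loop_conflictVertices {C : Placement n m B} {d : Demand n m}
    {cs : List (Finset (Label n m B))} (h : Run gcc2Loop (conflictVertices C d) cs) :
    cs.length ≤ (Finset.univ.image d).card * B := by
  refine (length_le_of_run_gcc2Loop h).trans ?_
  have hsub : (conflictVertices C d).image Label.packet ⊆
      (Finset.univ.image d) ×ˢ (Finset.univ : Finset (Fin B)) := by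
    intro r hr
    obtain ⟨v, hv, rfl⟩ := Finset.mem_image.1 hr
    have h1 := (Finset.mem_filter.1 (Finset.mem_filter.1 hv).2.1).2.1
    exact Finset.mem_product.2
      ⟨Finset.mem_image.2 ⟨v.requester, Finset.mem_univ _, h1.symm⟩, Finset.mem_univ _⟩
  simpa using Finset.card_le_card hsub

end Coloring

/-! ### Concentration of the cached fractions under the random placement. -/

section Placement

theorem isProbabilityMeasure_uniformOn_card {B c : ℕ} (hc : c ≤ B) :
    IsProbabilityMeasure (ProbabilityTheory.uniformOn {S : Finset (Fin B) | S.card = c}) := by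
  refine ProbabilityTheory.isProbabilityMeasure_uniformOn (Set.toFinite _) ?_
  obtain ⟨S, -, hS⟩ := Finset.exists_subset_card_eq (s := (Finset.univ : Finset (Fin B)))
    (n := c) (by simpa using hc)
  exact ⟨S, hS⟩

theorem uniformOn_card_real_superset {B c : ℕ} (P : Finset (Fin B)) (hP : P.card ≤ c) :
    (ProbabilityTheory.uniformOn {S : Finset (Fin B) | S.card = c}).real {S | P ⊆ S}
      = ((B - P.card).choose (c - P.card) : ℝ) / (B.choose c : ℝ) := by
  have h1 : {S : Finset (Fin B) | S.card = c}
      = ((Finset.univ.powersetCard c : Finset (Finset (Fin B))) : Set (Finset (Fin B))) := by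
    ext S; simp
  have h2 : {S : Finset (Fin B) | P ⊆ S}
      = ((Finset.univ.filter (P ⊆ ·) : Finset (Finset (Fin B))) : Set (Finset (Fin B))) := by
    ext S; simp
  have h3 : (Finset.univ.powersetCard c : Finset (Finset (Fin B))) ∩ Finset.univ.filter (P ⊆ ·)
      = (Finset.univ.powersetCard c).filter (P ⊆ ·) := by
    ext S; simp
  rw [Measure.real, h1, h2, ProbabilityTheory.uniformOn_apply_finset, h3,
    Finset.card_filter_powersetCard_subset P _ c (Finset.subset_univ _) hP]
  simp

/-- The indicator function of membership as a real number. -/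
noncomputable def memIndicator {α : Type*} [DecidableEq α] (j : α) (S : Finset α) : ℝ :=
  if j ∈ S then 1 else 0

/-- The mean is a ratio of numbers of supersets. Written with falling factorials, it also covers
`P.card > c`, where it vanishes. -/
theorem integral_prod_memIndicator {B c : ℕ} (hc : c ≤ B) (P : Finset (Fin B)) :
    ∫ S, ∏ j ∈ P, memIndicator j S
        ∂(ProbabilityTheory.uniformOn {S : Finset (Fin B) | S.card = c})
      = (c.descFactorial P.card : ℝ) / (B.descFactorial P.card : ℝ) := by
  have hf : (fun S : Finset (Fin B) => ∏ j ∈ P, memIndicator j S)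
      = Set.indicator {S | P ⊆ S} 1 := by
    ext S
    by_cases h : P ⊆ S
    · rw [Set.indicator_of_mem (by exact h)]
      exact Finset.prod_eq_one fun j hj => if_pos (h hj)
    · rw [Set.indicator_of_notMem (by exact h)]
      obtain ⟨j, hj, hjS⟩ := Finset.not_subset.1 h
      exact Finset.prod_eq_zero hj (if_neg hjS)
  rw [hf, integral_indicator_one (Set.toFinite _).measurableSet]
  have hPB : P.card ≤ B := by simpa using P.card_le_univ
  rcases le_or_gt P.card c with hP | hP
  · rw [uniformOn_card_real_superset P hP]
    have h1 : (0 : ℝ) < B.choose c := by exact_mod_cast Nat.choose_pos hc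
    have h2 : (0 : ℝ) < B.descFactorial P.card := by
      exact_mod_cast Nat.descFactorial_pos.2 hPB
    rw [div_eq_div_iff h1.ne' h2.ne']
    have h3 := Nat.choose_mul (n := B) hP
    rw [Nat.descFactorial_eq_factorial_mul_choose, Nat.descFactorial_eq_factorial_mul_choose]
    push_cast
    have h4 : (B.choose c : ℝ) * (c.choose P.card) =
      B.choose P.card * ((B - P.card).choose (c - P.card)) := by exact_mod_cast h3
    linear_combination (-(P.card.factorial : ℝ)) * h4
  · rw [Nat.descFactorial_of_lt hP, Nat.cast_zero, zero_div]
    have := isProbabilityMeasure_uniformOn_card hc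
    rw [measureReal_eq_zero_iff, ProbabilityTheory.uniformOn_eq_zero_iff (Set.toFinite _)]
    ext S
    simp only [Set.mem_inter_iff, Set.mem_ofPred_eq, Set.mem_empty_iff_false, iff_false, not_and]
    intro hS hPS
    exact absurd (Finset.card_le_card hPS) (by omega)

/-- The probability that a uniform `c`-subset of `B` points contains a given point. -/
noncomputable def inclProb (B c : ℕ) : ℝ := (c : ℝ) / B

/-- The probability that a uniform `c`-subset of `B` points contains two given distinct points. -/
noncomputable def inclProbPair (B c : ℕ) : ℝ :=
  inclProb B c * ((inclProb B c - 1 / B) / (1 - 1 / B))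

theorem integral_memIndicator {B c : ℕ} (hc : c ≤ B) (j : Fin B) :
    ∫ S, memIndicator j S ∂(ProbabilityTheory.uniformOn {S : Finset (Fin B) | S.card = c})
      = inclProb B c := by
  have h := integral_prod_memIndicator hc {j}
  simpa [inclProb] using h

/-- The value is `c (c - 1) / (B (B - 1))`, with numerator and denominator divided by `B ^ 2` so
that its limit can be read off from that of `c / B`. -/
theorem integral_memIndicator_mul {B c : ℕ} (hc : c ≤ B) {i j : Fin B} (hij : i ≠ j) :
    ∫ S, memIndicator i S * memIndicator j S
        ∂(ProbabilityTheory.uniformOn {S : Finset (Fin B) | S.card = c})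
      = inclProbPair B c := by
  have h := integral_prod_memIndicator hc {i, j}
  rw [Finset.card_pair hij] at h
  simp only [Finset.prod_pair hij] at h
  rw [h, inclProbPair, inclProb]
  have hB : 2 ≤ B := by
    have := i.2; have := j.2
    have : (i : ℕ) ≠ j := fun h => hij (Fin.ext h)
    omega
  have e : ∀ a : ℕ, ((a.descFactorial 2 : ℕ) : ℝ) = a * (a - 1) := by
    intro a
    rcases a with _ | a
    · simp
    · simp [Nat.descFactorial]; ring
  rw [e, e]
  have h2 : (2 : ℝ) ≤ B := by exact_mod_cast hB
  have h0 : (B : ℝ) ≠ 0 := by linarith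
  have h1 : (B : ℝ) - 1 ≠ 0 := by linarith
  field_simp

/-- The indicator of membership of `j` or of its negation, according to `b`. -/
noncomputable def signIndicator {α : Type*} [DecidableEq α] (b : Prop) [Decidable b]
    (j : α) (S : Finset α) : ℝ :=
  if b then memIndicator j S else 1 - memIndicator j S

/-- The mean of `signIndicator`. -/
noncomputable def signProb (b : Prop) [Decidable b] (B c : ℕ) : ℝ :=
  if b then inclProb B c else 1 - inclProb B c

/-- The mean of the product of `signIndicator` at two distinct points. -/
noncomputable def signProbPair (b : Prop) [Decidable b] (B c : ℕ) : ℝ :=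
  if b then inclProbPair B c else 1 - 2 * inclProb B c + inclProbPair B c

theorem integral_signIndicator (b : Prop) [Decidable b] {B c : ℕ} (hc : c ≤ B) (j : Fin B) :
    ∫ S, signIndicator b j S ∂(ProbabilityTheory.uniformOn {S : Finset (Fin B) | S.card = c})
      = signProb b B c := by
  have := isProbabilityMeasure_uniformOn_card hc
  unfold signIndicator signProb
  split_ifs
  · exact integral_memIndicator hc j
  · rw [integral_sub .of_finite .of_finite, integral_memIndicator hc j]
    simp

theorem integral_signIndicator_mul (b : Prop) [Decidable b] {B c : ℕ} (hc : c ≤ B) {i j : Fin B}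
    (hij : i ≠ j) :
    ∫ S, signIndicator b i S * signIndicator b j S
        ∂(ProbabilityTheory.uniformOn {S : Finset (Fin B) | S.card = c})
      = signProbPair b B c := by
  have := isProbabilityMeasure_uniformOn_card hc
  unfold signIndicator signProbPair
  split_ifs
  · exact integral_memIndicator_mul hc hij
  · have e : ∀ S : Finset (Fin B), (1 - memIndicator i S) * (1 - memIndicator j S)
        = 1 - memIndicator i S - memIndicator j S + memIndicator i S * memIndicator j S := by
      intro S; ring
    simp_rw [e]
    rw [integral_add .of_finite .of_finite, integral_sub .of_finite .of_finite,
      integral_sub .of_finite .of_finite, integral_memIndicator hc i, integral_memIndicator hc j,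
      integral_memIndicator_mul hc hij]
    simp
    ring

theorem signIndicator_mul_self {α : Type*} [DecidableEq α] (b : Prop) [Decidable b]
    (j : α) (S : Finset α) :
    signIndicator b j S * signIndicator b j S = signIndicator b j S := by
  unfold signIndicator memIndicator
  split_ifs <;> simp

variable {n m B : ℕ}

/-- Each packet's indicator becomes a product over users, so that its mean factors by independence.
-/
theorem card_exactlyCached (C : Placement n m B) (f : Fin m) (T : Finset (Fin n)) :
    ((exactlyCached C f T).card : ℝ) = ∑ j, ∏ u, signIndicator (u ∈ T) j (C u f) := by
  rw [exactlyCached, Finset.card_filter, Nat.cast_sum]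
  refine Finset.sum_congr rfl fun j _ => ?_
  split_ifs with h
  · subst h
    rw [Nat.cast_one, eq_comm]
    refine Finset.prod_eq_one fun u _ => ?_
    simp only [signIndicator, memIndicator, Finset.mem_filter, Finset.mem_univ, true_and]
    split_ifs <;> simp
  · rw [Finset.ext_iff] at h
    push Not at h
    obtain ⟨u, hu⟩ := h
    rw [Nat.cast_zero, eq_comm]
    refine Finset.prod_eq_zero (Finset.mem_univ u) ?_
    simp only [signIndicator, memIndicator, Finset.mem_filter, Finset.mem_univ, true_and] at hu ⊢
    split_ifs <;> simp_all

theorem integral_placementLaw_prod {M : ℝ} {p : Fin m → ℝ} (hp : ∀ f, ⌊p f * M * B⌋₊ ≤ B)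
    (f : Fin m) (g : Fin n → Finset (Fin B) → ℝ) :
    ∫ C, ∏ u, g u (C u f) ∂(placementLaw n B M p)
      = ∏ u, ∫ S, g u S
          ∂(ProbabilityTheory.uniformOn {S : Finset (Fin B) | S.card = ⌊p f * M * B⌋₊}) := by
  have inst : ∀ f, IsProbabilityMeasure
      (ProbabilityTheory.uniformOn {S : Finset (Fin B) | S.card = ⌊p f * M * B⌋₊}) :=
    fun f => isProbabilityMeasure_uniformOn_card (hp f)
  rw [placementLaw, integral_fintype_prod_eq_prod (fun u (x : Fin m → Finset (Fin B)) => g u (x f))]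
  refine Finset.prod_congr rfl fun u _ => ?_
  have hmp := measurePreserving_eval (fun f : Fin m =>
    ProbabilityTheory.uniformOn {S : Finset (Fin B) | S.card = ⌊p f * M * B⌋₊}) f
  have hmap := integral_map (f := g u) hmp.measurable.aemeasurable
    (by rw [hmp.map_eq]; exact Integrable.of_finite.aestronglyMeasurable)
  rw [hmp.map_eq] at hmap
  exact hmap.symm

theorem isProbabilityMeasure_placementLaw {M : ℝ} {p : Fin m → ℝ}
    (hp : ∀ f, ⌊p f * M * B⌋₊ ≤ B) : IsProbabilityMeasure (placementLaw n B M p) := by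
  have inst : ∀ f, IsProbabilityMeasure
      (ProbabilityTheory.uniformOn {S : Finset (Fin B) | S.card = ⌊p f * M * B⌋₊}) :=
    fun f => isProbabilityMeasure_uniformOn_card (hp f)
  unfold placementLaw
  infer_instance

/-- The mean squared deviation of the fraction of packets of a file cached by exactly the users
in `T` from a number `z`, when each user caches a uniform set of `c` out of `B` packets. -/
noncomputable def squareDeviation (T : Finset (Fin n)) (z : ℝ) (B c : ℕ) : ℝ :=
  (1 / B) * ∏ u, signProb (u ∈ T) B c + (1 - 1 / B) * ∏ u, signProbPair (u ∈ T) B c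
    - 2 * z * ∏ u, signProb (u ∈ T) B c + z ^ 2

/-- Expanding the square gives a sum over pairs of packets. The `B` diagonal pairs reduce to single
means because indicators are idempotent; the other `B (B - 1)` pairs all have the same mean. -/
theorem integral_card_exactlyCached_div_sub_sq (hB : 0 < B) {M : ℝ} {p : Fin m → ℝ}
    (hp : ∀ f, ⌊p f * M * B⌋₊ ≤ B) (f : Fin m) (T : Finset (Fin n)) (z : ℝ) :
    ∫ C, (((exactlyCached C f T).card : ℝ) / B - z) ^ 2 ∂(placementLaw n B M p)
      = squareDeviation T z B ⌊p f * M * B⌋₊ := by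
  have := isProbabilityMeasure_placementLaw (n := n) hp
  set c := ⌊p f * M * B⌋₊ with hcdef
  have hB' : (B : ℝ) ≠ 0 := by positivity
  have h1 : ∀ j : Fin B, ∫ C, ∏ u, signIndicator (u ∈ T) j (C u f) ∂(placementLaw n B M p)
      = ∏ u, signProb (u ∈ T) B c := by
    intro j
    rw [integral_placementLaw_prod hp f fun u S => signIndicator (u ∈ T) j S]
    exact Finset.prod_congr rfl fun u _ => integral_signIndicator _ (hp f) j
  have h2 : ∀ i j : Fin B, ∫ C, (∏ u, signIndicator (u ∈ T) i (C u f)) *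
      (∏ u, signIndicator (u ∈ T) j (C u f)) ∂(placementLaw n B M p)
      = if i = j then ∏ u, signProb (u ∈ T) B c else ∏ u, signProbPair (u ∈ T) B c := by
    intro i j
    split_ifs with hij
    · subst hij
      simp_rw [← Finset.prod_mul_distrib, signIndicator_mul_self]
      exact h1 i
    · simp_rw [← Finset.prod_mul_distrib]
      rw [integral_placementLaw_prod hp f
        fun u S => signIndicator (u ∈ T) i S * signIndicator (u ∈ T) j S]
      exact Finset.prod_congr rfl fun u _ => integral_signIndicator_mul _ (hp f) hij
  have e : ∀ C : Placement n m B, (((exactlyCached C f T).card : ℝ) / B - z) ^ 2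
      = (1 / (B : ℝ) ^ 2) * (∑ i, ∑ j, (∏ u, signIndicator (u ∈ T) i (C u f)) *
      (∏ u, signIndicator (u ∈ T) j (C u f)))
        - (2 * z / B) * (∑ j, ∏ u, signIndicator (u ∈ T) j (C u f)) + z ^ 2 := by
    intro C
    rw [card_exactlyCached, ← Finset.sum_mul_sum]
    field_simp
    ring
  simp_rw [e]
  rw [integral_add .of_finite .of_finite, integral_sub .of_finite .of_finite,
    integral_const_mul, integral_const_mul, integral_finsetSum _ fun _ _ => .of_finite,
    integral_finsetSum _ fun _ _ => .of_finite]
  simp_rw [integral_finsetSum _ fun _ _ => Integrable.of_finite, h1, h2]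
  have e2 : ∀ i : Fin B, (∑ j, if i = j then ∏ u, signProb (u ∈ T) B c
      else ∏ u, signProbPair (u ∈ T) B c)
      = ∏ u, signProb (u ∈ T) B c + (B - 1) * ∏ u, signProbPair (u ∈ T) B c := by
    intro i
    have e3 : ∀ j, (if i = j then ∏ u, signProb (u ∈ T) B c else ∏ u, signProbPair (u ∈ T) B c)
        = (if i = j then ∏ u, signProb (u ∈ T) B c - ∏ u, signProbPair (u ∈ T) B c else 0)
          + ∏ u, signProbPair (u ∈ T) B c := by
      intro j
      split_ifs <;> ring
    simp_rw [e3]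
    rw [Finset.sum_add_distrib, Finset.sum_ite_eq, if_pos (Finset.mem_univ i)]
    simp
    ring
  simp_rw [e2]
  simp [squareDeviation]
  field_simp

/-- Two distinct packets become independent in the limit, since `inclProbPair` tends to `x ^ 2`. The
expression thus tends to `z ^ 2 - 2 * z * z + z ^ 2`. -/
theorem tendsto_squareDeviation {x : ℝ} (hx : 0 ≤ x) (T : Finset (Fin n)) :
    Tendsto (fun B : ℕ => squareDeviation T (x ^ T.card * (1 - x) ^ (n - T.card)) B ⌊x * B⌋₊)
      atTop (𝓝 0) := by
  have hinv : Tendsto (fun B : ℕ => (1 : ℝ) / B) atTop (𝓝 0) := tendsto_one_div_atTop_nhds_zero_nat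
  have ha : Tendsto (fun B : ℕ => inclProb B ⌊x * B⌋₊) atTop (𝓝 x) :=
    (tendsto_nat_floor_mul_div_atTop hx).comp tendsto_natCast_atTop_atTop
  have hb : Tendsto (fun B : ℕ => inclProbPair B ⌊x * B⌋₊) atTop (𝓝 (x * ((x - 0) / (1 - 0)))) :=
    ha.mul ((ha.sub hinv).div (tendsto_const_nhds.sub hinv) (by norm_num))
  have hA : ∀ u : Fin n, Tendsto (fun B : ℕ => signProb (u ∈ T) B ⌊x * B⌋₊) atTop
      (𝓝 (if u ∈ T then x else 1 - x)) := by
    intro u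
    unfold signProb
    split_ifs
    · exact ha
    · exact tendsto_const_nhds.sub ha
  have hD : ∀ u : Fin n, Tendsto (fun B : ℕ => signProbPair (u ∈ T) B ⌊x * B⌋₊) atTop
      (𝓝 ((if u ∈ T then x else 1 - x) ^ 2)) := by
    intro u
    unfold signProbPair
    split_ifs
    · convert hb using 2; ring
    · convert (tendsto_const_nhds.sub (ha.const_mul 2)).add hb using 2; ring
  have hz : x ^ T.card * (1 - x) ^ (n - T.card) = ∏ u : Fin n, if u ∈ T then x else 1 - x := by
    rw [Finset.prod_ite]
    simp [Finset.filter_not, Finset.card_sdiff]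
  rw [hz]
  set z := ∏ u : Fin n, if u ∈ T then x else 1 - x with hzdef
  have hPA := tendsto_finsetProd Finset.univ fun u _ => hA u
  have hPD := tendsto_finsetProd Finset.univ fun u _ => hD u
  rw [Finset.prod_pow] at hPD
  have := ((hinv.mul hPA).add (((tendsto_const_nhds (x := (1 : ℝ))).sub hinv).mul hPD)).sub
    (hPA.const_mul (2 * z)) |>.add_const (z ^ 2)
  rw [← hzdef] at this
  rw [show 0 * z + (1 - 0) * z ^ 2 - 2 * z * z + z ^ 2 = 0 by ring] at this
  exact this

/-- Markov's inequality for the squared deviation. -/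
theorem placementLaw_real_abs_sub_ge_le (hB : 0 < B) {M : ℝ} {p : Fin m → ℝ}
    (hp : ∀ f, ⌊p f * M * B⌋₊ ≤ B) (f : Fin m) (T : Finset (Fin n)) (z : ℝ) {δ : ℝ} (hδ : 0 < δ) :
    (placementLaw n B M p).real {C | δ < |((exactlyCached C f T).card : ℝ) / B - z|}
      ≤ squareDeviation T z B ⌊p f * M * B⌋₊ / δ ^ 2 := by
  have := isProbabilityMeasure_placementLaw (n := n) hp
  rw [← integral_card_exactlyCached_div_sub_sq hB hp f T z, le_div_iff₀ (by positivity), mul_comm]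
  refine le_trans ?_ (mul_meas_ge_le_integral_of_nonneg (ae_of_all _ fun C => sq_nonneg _)
    .of_finite (δ ^ 2))
  refine mul_le_mul_of_nonneg_left (measureReal_mono fun C hC => ?_) (by positivity)
  have hC' : δ < |((exactlyCached C f T).card : ℝ) / B - z| := hC
  change δ ^ 2 ≤ _
  rw [← sq_abs (_ - z)]
  gcongr

/-- With probability tending to one, all the fractions of packets of a file cached by exactly a
given set of users are close to their limits. -/
theorem tendsto_placementLaw_abs_sub_le {M : ℝ} {p : Fin m → ℝ} (hp0 : ∀ f, 0 ≤ p f * M)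
    (hp1 : ∀ f, p f * M ≤ 1) {B : ℕ → ℕ} (hB : Tendsto B atTop atTop) {δ : ℝ} (hδ : 0 < δ) :
    Tendsto (fun F => placementLaw n (B F) M p {C | ∀ f, ∀ T : Finset (Fin n),
      |((exactlyCached C f T).card : ℝ) / B F
        - (p f * M) ^ T.card * (1 - p f * M) ^ (n - T.card)| ≤ δ}) atTop (𝓝 1) := by
  have hp : ∀ B f, ⌊p f * M * (B : ℕ)⌋₊ ≤ B := fun B f =>
    Nat.floor_le_of_le (mul_le_of_le_one_left (Nat.cast_nonneg B) (hp1 f))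
  have hprob : ∀ F, IsProbabilityMeasure (placementLaw n (B F) M p) :=
    fun F => isProbabilityMeasure_placementLaw (hp (B F))
  set z : Fin m → Finset (Fin n) → ℝ :=
    fun f T => (p f * M) ^ T.card * (1 - p f * M) ^ (n - T.card) with hz
  -- Union bound: the number of pairs `(f, T)` does not depend on `F`, so the total failure
  -- probability vanishes.
  have hlim : Tendsto (fun F => 1 - ∑ f, ∑ T : Finset (Fin n),
      squareDeviation T (z f T) (B F) ⌊p f * M * B F⌋₊ / δ ^ 2) atTop (𝓝 (1 - 0)) := by
    refine tendsto_const_nhds.sub ?_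
    rw [show (0 : ℝ) = ∑ f : Fin m, ∑ T : Finset (Fin n), 0 / δ ^ 2 by simp]
    refine tendsto_finsetSum _ fun f _ => tendsto_finsetSum _ fun T _ => ?_
    exact ((tendsto_squareDeviation (hp0 f) T).comp hB).div_const _
  rw [sub_zero] at hlim
  have hreal : Tendsto (fun F => (placementLaw n (B F) M p).real {C | ∀ f, ∀ T : Finset (Fin n),
      |((exactlyCached C f T).card : ℝ) / B F - z f T| ≤ δ}) atTop (𝓝 1) := by
    refine tendsto_of_tendsto_of_tendsto_of_le_of_le' hlim tendsto_const_nhds ?_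
      (Eventually.of_forall fun F => measureReal_le_one)
    filter_upwards [hB.eventually_gt_atTop 0] with F hF
    have hcompl : {C : Placement n m (B F) | ∀ f, ∀ T : Finset (Fin n),
        |((exactlyCached C f T).card : ℝ) / B F - z f T| ≤ δ}ᶜ
        = ⋃ f, ⋃ T, {C | δ < |((exactlyCached C f T).card : ℝ) / B F - z f T|} := by
      ext C
      simp
    have h1 := probReal_add_probReal_compl (μ := placementLaw n (B F) M p)
      (s := {C | ∀ f, ∀ T : Finset (Fin n),
        |((exactlyCached C f T).card : ℝ) / B F - z f T| ≤ δ}) (Set.toFinite _).measurableSet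
    rw [hcompl] at h1
    have h2 : (placementLaw n (B F) M p).real
        (⋃ f, ⋃ T, {C | δ < |((exactlyCached C f T).card : ℝ) / B F - z f T|})
        ≤ ∑ f, ∑ T : Finset (Fin n),
          squareDeviation T (z f T) (B F) ⌊p f * M * B F⌋₊ / δ ^ 2 := by
      refine (measureReal_iUnion_fintype_le _).trans (Finset.sum_le_sum fun f _ =>
        (measureReal_iUnion_fintype_le _).trans (Finset.sum_le_sum fun T _ => ?_))
      exact placementLaw_real_abs_sub_ge_le hF (hp (B F)) f T _ hδ
    linarith
  have := ENNReal.tendsto_ofReal hreal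
  rw [ENNReal.ofReal_one] at this
  refine this.congr fun F => ?_
  exact ofReal_measureReal

end Placement

/-! ### The limiting number of colors for a given set of users requesting cached files. -/

section HeadTail

variable {n : ℕ}

/-- The limit of the normalized number of colors used by the first algorithm for the vertices
with set of requesting or caching users `S`, when the users in `H` request cached files. -/
noncomputable def colorDensity (x : ℝ) (H S : Finset (Fin n)) : ℝ :=
  -- The truncated subtraction is harmless, as a set meeting `H` is nonempty. At most one of the two
  -- terms is nonzero, since a singleton outside `H` is disjoint from `H`.
  (if Disjoint S H then 0 else x ^ (S.card - 1) * (1 - x) ^ (n - (S.card - 1)))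
    + if S ∈ Hᶜ.image singleton then 1 else 0

theorem colorDensity_nonneg {x : ℝ} (hx0 : 0 ≤ x) (hx1 : x ≤ 1) (H S : Finset (Fin n)) :
    0 ≤ colorDensity x H S := by
  have : 0 ≤ 1 - x := by linarith
  unfold colorDensity
  split_ifs <;> positivity

/-- A user in `H` is covered by the first term. For a user outside `H` the density is `0 ^ (S.card -
1)`, which is nonzero only for `S = {u}`, and there the second term is `1`. -/
theorem le_colorDensity {x : ℝ} (hx0 : 0 ≤ x) (hx1 : x ≤ 1) (H : Finset (Fin n))
    {S : Finset (Fin n)} {u : Fin n} (hu : u ∈ S) :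
    (if u ∈ H then x else 0) ^ (S.erase u).card
      * (1 - if u ∈ H then x else 0) ^ (n - (S.erase u).card) ≤ colorDensity x H S := by
  have hx : 0 ≤ 1 - x := by linarith
  rw [Finset.card_erase_of_mem hu]
  by_cases huH : u ∈ H
  · rw [if_pos huH, colorDensity, if_neg (Finset.not_disjoint_iff.2 ⟨u, hu, huH⟩)]
    exact le_add_of_nonneg_right (by split_ifs <;> norm_num)
  · rw [if_neg huH]
    by_cases hS : S.card - 1 = 0
    · have hS1 : S = {u} := by
        have : S.card = 1 := by
          have := Finset.card_pos.2 ⟨u, hu⟩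
          omega
        obtain ⟨a, rfl⟩ := Finset.card_eq_one.1 this
        rw [Finset.mem_singleton.1 hu]
      have hmem : S ∈ Hᶜ.image singleton :=
        Finset.mem_image.2 ⟨u, Finset.mem_compl.2 huH, hS1.symm⟩
      rw [hS, colorDensity, if_pos hmem]
      simp only [pow_zero, sub_zero, one_pow, mul_one]
      exact le_add_of_nonneg_left (by split_ifs <;> positivity)
    · rw [zero_pow hS, zero_mul]
      exact colorDensity_nonneg hx0 hx1 H S

/-- Multiplied by `x`, the first term is `1 - x` times the probability that a random set, containing
each user independently with probability `x`, equals `S`. Such a set misses `H` with probability `(1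
- x) ^ H.card`. The second terms count the users outside `H`. -/
theorem sum_colorDensity {x : ℝ} (hx : x ≠ 0) (H : Finset (Fin n)) :
    ∑ S, colorDensity x H S = (1 / x - 1) * (1 - (1 - x) ^ H.card) + (n - H.card) := by
  have hHn : H.card ≤ n := by simpa using H.card_le_univ
  simp only [colorDensity]
  rw [Finset.sum_add_distrib]
  congr 1
  · have hall : ∑ S : Finset (Fin n), x ^ S.card * (1 - x) ^ (n - S.card) = 1 := by
      have := Finset.sum_pow_mul_eq_add_pow x (1 - x) (Finset.univ : Finset (Fin n))
      simpa using this
    have hdisj : ∑ S : Finset (Fin n), (if Disjoint S H then x ^ S.card * (1 - x) ^ (n - S.card)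
        else 0) = (1 - x) ^ H.card := by
      rw [← Finset.sum_filter]
      have hf : (Finset.univ.filter fun S : Finset (Fin n) => Disjoint S H) = Hᶜ.powerset := by
        ext S
        simp [Finset.subset_compl_iff_disjoint_right]
      rw [hf]
      have h := Finset.sum_pow_mul_eq_add_pow x (1 - x) Hᶜ
      rw [add_sub_cancel, one_pow] at h
      calc ∑ S ∈ Hᶜ.powerset, x ^ S.card * (1 - x) ^ (n - S.card)
          = ∑ S ∈ Hᶜ.powerset, (1 - x) ^ H.card
            * (x ^ S.card * (1 - x) ^ (Hᶜ.card - S.card)) := by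
            refine Finset.sum_congr rfl fun S hS => ?_
            have h1 := Finset.card_le_card (Finset.mem_powerset.1 hS)
            have h2 : Hᶜ.card = n - H.card := by simp [Finset.card_compl]
            rw [show n - S.card = H.card + (Hᶜ.card - S.card) by omega, pow_add]
            ring
        _ = (1 - x) ^ H.card := by rw [← Finset.mul_sum, h, mul_one]
    have hterm : ∀ S : Finset (Fin n),
        x * (if Disjoint S H then 0 else x ^ (S.card - 1) * (1 - x) ^ (n - (S.card - 1)))
        = (1 - x) * (x ^ S.card * (1 - x) ^ (n - S.card)
          - if Disjoint S H then x ^ S.card * (1 - x) ^ (n - S.card) else 0) := by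
      intro S
      split_ifs with h
      · simp
      · obtain ⟨u, hu, -⟩ := Finset.not_disjoint_iff.1 h
        have h1 := Finset.card_pos.2 ⟨u, hu⟩
        have h2 : S.card ≤ n := by simpa using S.card_le_univ
        obtain ⟨s, hs⟩ := Nat.exists_eq_add_of_le' h1
        rw [hs, Nat.add_sub_cancel, show n - s = n - (s + 1) + 1 by omega]
        ring
    have hsum : x * ∑ S : Finset (Fin n),
        (if Disjoint S H then 0 else x ^ (S.card - 1) * (1 - x) ^ (n - (S.card - 1)))
        = (1 - x) * (1 - (1 - x) ^ H.card) := by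
      rw [Finset.mul_sum, Finset.sum_congr rfl fun S _ => hterm S, ← Finset.mul_sum,
        Finset.sum_sub_distrib, hall, hdisj]
    rw [show (1 / x - 1) = (1 - x) / x by field_simp, div_mul_eq_mul_div, ← hsum,
      mul_div_cancel_left₀ _ hx]
  · rw [Finset.sum_ite_mem, Finset.univ_inter, Finset.sum_const, Finset.card_image_of_injective _
      (Finset.singleton_injective), Finset.card_compl, Fintype.card_fin, nsmul_eq_mul, mul_one,
      Nat.cast_sub hHn]

end HeadTail

/-! ### Averages over the random requests. -/

section Demand

variable {n m : ℕ}

theorem sum_demand_prod (g : Fin n → Fin m → ℝ) :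
    ∑ d : Demand n m, ∏ u, g u (d u) = ∏ u, ∑ f, g u f := by
  rw [Finset.prod_univ_sum, Fintype.piFinset_univ]

theorem sum_demand_weight {q : Fin m → ℝ} (hq : ∑ f, q f = 1) :
    ∑ d : Demand n m, ∏ u, q (d u) = 1 := by
  rw [sum_demand_prod fun _ => q]
  simp [hq]

/-- The users that request one of the first `k` files. -/
def headUsers (k : ℕ) (d : Demand n m) : Finset (Fin n) :=
  Finset.univ.filter fun u => (d u : ℕ) < k

theorem sum_demand_card_headUsers {q : Fin m → ℝ} (hq : ∑ f, q f = 1) (k : ℕ) :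
    ∑ d : Demand n m, (∏ u, q (d u)) * ((headUsers k d).card : ℝ) = n * headMass q k := by
  -- The indicator for user `v` is absorbed as the factor at `u = v`, so that the sum over demands
  -- factors.
  have e : ∀ d : Demand n m, (∏ u, q (d u)) * ((headUsers k d).card : ℝ)
      = ∑ v, ∏ u, q (d u) * (if u = v then (if (d u : ℕ) < k then 1 else 0) else 1) := by
    intro d
    rw [headUsers, Finset.card_filter, Nat.cast_sum, Finset.mul_sum]
    refine Finset.sum_congr rfl fun v _ => ?_
    rw [Finset.prod_mul_distrib, Finset.prod_ite_eq']
    simp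
  simp_rw [e]
  rw [Finset.sum_comm]
  have e2 : ∀ v : Fin n, ∑ d : Demand n m,
      ∏ u, q (d u) * (if u = v then (if (d u : ℕ) < k then 1 else 0) else 1) = headMass q k := by
    intro v
    rw [sum_demand_prod fun u f => q f * (if u = v then (if (f : ℕ) < k then 1 else 0) else 1)]
    rw [Finset.prod_eq_single v]
    · simp [headMass]
    · intro u _ huv
      simp [huv, hq]
    · simp
  rw [Finset.sum_congr rfl fun v _ => e2 v]
  simp

/-- This is the generating function of a binomial variable with parameters `n` and `headMass q k`,
evaluated at `1 - x`. -/
theorem sum_demand_pow_card_headUsers {q : Fin m → ℝ} (hq : ∑ f, q f = 1) (k : ℕ) (x : ℝ) :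
    ∑ d : Demand n m, (∏ u, q (d u)) * (1 - x) ^ (headUsers k d).card
      = (1 - x * headMass q k) ^ n := by
  have e : ∀ d : Demand n m, (∏ u, q (d u)) * (1 - x) ^ (headUsers k d).card
      = ∏ u, (q (d u) - x * if (d u : ℕ) < k then q (d u) else 0) := by
    intro d
    rw [headUsers, ← Finset.prod_const, Finset.prod_filter, ← Finset.prod_mul_distrib]
    refine Finset.prod_congr rfl fun u _ => ?_
    split_ifs <;> ring
  simp_rw [e]
  rw [sum_demand_prod fun _ f => q f - x * if (f : ℕ) < k then q f else 0, Finset.prod_const,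
    Finset.sum_sub_distrib, hq, ← Finset.mul_sum, headMass]
  simp

/-- By linearity over files: a file is counted unless all users avoid it, and the subtracted product
vanishes as soon as one user requests it. -/
theorem sum_demand_card_image {q : Fin m → ℝ} (hq : ∑ f, q f = 1) :
    ∑ d : Demand n m, (∏ u, q (d u)) * ((Finset.univ.image d).card : ℝ) = mBar n q := by
  have e : ∀ d : Demand n m, (∏ u, q (d u)) * ((Finset.univ.image d).card : ℝ)
      = ∑ f, (∏ u, q (d u) - ∏ u, (q (d u) - if d u = f then q (d u) else 0)) := by
    intro d
    have hc : ((Finset.univ.image d).card : ℝ) = ∑ f, if f ∈ Finset.univ.image d then 1 else 0 := by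
      simp
    rw [hc, Finset.mul_sum]
    refine Finset.sum_congr rfl fun f _ => ?_
    split_ifs with hf
    · obtain ⟨u, -, hu⟩ := Finset.mem_image.1 hf
      rw [Finset.prod_eq_zero (f := fun u => q (d u) - if d u = f then q (d u) else 0)
        (Finset.mem_univ u) (by simp [hu])]
      ring
    · have : ∀ u, d u ≠ f := fun u hu => hf (Finset.mem_image.2 ⟨u, Finset.mem_univ _, hu⟩)
      simp [this]
  simp_rw [e]
  rw [Finset.sum_comm, mBar]
  refine Finset.sum_congr rfl fun f _ => ?_
  rw [Finset.sum_sub_distrib, sum_demand_weight hq,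
    sum_demand_prod fun _ g => q g - if g = f then q g else 0]
  simp [hq]

theorem headMass_nonneg {q : Fin m → ℝ} (hq0 : ∀ f, 0 ≤ q f) (k : ℕ) : 0 ≤ headMass q k :=
  Finset.sum_nonneg fun f _ => by split_ifs <;> simp [hq0 f]

theorem headMass_le_one {q : Fin m → ℝ} (hq0 : ∀ f, 0 ≤ q f) (hq : ∑ f, q f = 1) (k : ℕ) :
    headMass q k ≤ 1 := by
  rw [← hq]
  exact Finset.sum_le_sum fun f _ => by split_ifs <;> simp [hq0 f]

/-- Averaging the number of colors of the first algorithm over the demands (by Bernoulli's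
inequality, a form of Jensen's inequality). -/
theorem sum_demand_sum_colorDensity_le {q : Fin m → ℝ} (hq0 : ∀ f, 0 ≤ q f)
    (hq : ∑ f, q f = 1) {k : ℕ} {M : ℝ} (hM : 0 < M) (hMk : M ≤ k) :
    ∑ d : Demand n m, (∏ u, q (d u)) * ∑ S, colorDensity (M / k) (headUsers k d) S
      ≤ psiTilde n M q k := by
  have hk : (0 : ℝ) < k := hM.trans_le hMk
  set x := M / k with hx
  have hx0 : 0 < x := div_pos hM hk
  have hx1 : x ≤ 1 := (div_le_one hk).2 hMk
  have hkM : (k : ℝ) / M = 1 / x := by rw [hx, one_div_div]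
  have hG0 := headMass_nonneg hq0 k
  have hG1 := headMass_le_one hq0 hq k
  have e : ∀ d : Demand n m, (∏ u, q (d u)) * ∑ S, colorDensity x (headUsers k d) S
      = (1 / x - 1 + n) * (∏ u, q (d u))
        - (1 / x - 1) * ((∏ u, q (d u)) * (1 - x) ^ (headUsers k d).card)
        - (∏ u, q (d u)) * ((headUsers k d).card : ℝ) := by
    intro d
    rw [sum_colorDensity hx0.ne']
    ring
  simp_rw [e]
  rw [Finset.sum_sub_distrib, Finset.sum_sub_distrib, ← Finset.mul_sum, ← Finset.mul_sum,
    sum_demand_weight hq, sum_demand_card_headUsers hq, sum_demand_pow_card_headUsers hq,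
    psiTilde, hkM, ← hx]
  -- Bernoulli's inequality with exponent `headMass q k` in `[0, 1]` gives `(1 - x) ^ G ≤ 1 - x *
  -- G`; the `n`-th power of both sides is then taken.
  have hb : (1 - x) ^ ((n : ℝ) * headMass q k) ≤ (1 - x * headMass q k) ^ n := by
    rw [mul_comm, Real.rpow_mul_natCast (by linarith)]
    refine pow_le_pow_left₀ (Real.rpow_nonneg (by linarith) _) ?_ n
    have := rpow_one_add_le_one_add_mul_self (s := -x) (by linarith) hG0 hG1
    rw [← sub_eq_add_neg] at this
    linarith
  have hx2 : 0 ≤ 1 / x - 1 := sub_nonneg.2 ((one_le_div hx0).2 hx1)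
  linarith [mul_le_mul_of_nonneg_left hb hx2]

end Demand

/-! ### Bounds on the conditional rate. -/

section Rate

variable {n m k B : ℕ}

theorem truncatedUniform_mul (M : ℝ) (f : Fin m) :
    truncatedUniform m k f * M = if (f : ℕ) < k then M / k else 0 := by
  unfold truncatedUniform
  split_ifs
  · ring
  · ring

theorem conditionalRate_le_mBar {q : Fin m → ℝ} (hq0 : ∀ f, 0 ≤ q f) (hq : ∑ f, q f = 1)
    (hB : 0 < B) {N : Placement n m B → Demand n m → ℕ} {C : Placement n m B}
    (hN : ∀ d, IsGCCColorCount C d (N C d)) : conditionalRate q N C ≤ mBar n q := by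
  rw [conditionalRate, div_le_iff₀ (by exact_mod_cast hB), ← sum_demand_card_image hq,
    Finset.sum_mul]
  refine Finset.sum_le_sum fun d _ => ?_
  rw [mul_assoc]
  refine mul_le_mul_of_nonneg_left ?_ (Finset.prod_nonneg fun u _ => hq0 _)
  obtain ⟨cs₁, cs₂, -, h₂, h⟩ := hN d
  rw [h]
  exact_mod_cast (min_le_right _ _).trans (length_le_of_run_gcc2Loop_conflictVertices h₂)

/-- Each of the `2 ^ n` user sets `S` contributes an error of at most `δ`. -/
theorem conditionalRate_le_psiTilde_add {q : Fin m → ℝ} (hq0 : ∀ f, 0 ≤ q f)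
    (hq : ∑ f, q f = 1) {M : ℝ} (hM : 0 < M) (hMk : M ≤ k) (hB : 0 < B)
    {N : Placement n m B → Demand n m → ℕ} {C : Placement n m B}
    (hN : ∀ d, IsGCCColorCount C d (N C d)) {δ : ℝ} (hδ : 0 ≤ δ)
    (hC : ∀ f, ∀ T : Finset (Fin n), |((exactlyCached C f T).card : ℝ) / B
        - (truncatedUniform m k f * M) ^ T.card
          * (1 - truncatedUniform m k f * M) ^ (n - T.card)| ≤ δ) :
    conditionalRate q N C ≤ psiTilde n M q k + 2 ^ n * δ := by
  have hk : (0 : ℝ) < k := hM.trans_le hMk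
  have hx0 : 0 ≤ M / k := (div_pos hM hk).le
  have hx1 : M / k ≤ 1 := (div_le_one hk).2 hMk
  have hB' : (0 : ℝ) < B := by exact_mod_cast hB
  have hcount : ∀ d, (N C d : ℝ) ≤ (∑ S, colorDensity (M / k) (headUsers k d) S + 2 ^ n * δ) * B := by
    intro d
    obtain ⟨cs₁, cs₂, h₁, -, h⟩ := hN d
    have hle : (N C d : ℝ) ≤ cs₁.length := by
      rw [h]
      exact_mod_cast min_le_left _ _
    have hsum := length_le_sum_of_run_gcc1Loop h₁
      (fun S => (colorDensity (M / k) (headUsers k d) S + δ) * B)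
      (fun S => mul_nonneg (add_nonneg (colorDensity_nonneg hx0 hx1 _ _) hδ) hB'.le)
      (fun S u hu => by
        have h1 := (abs_le.1 (hC (d u) (S.erase u))).2
        have h2 := le_colorDensity hx0 hx1 (headUsers k d) hu
        have h3 : (if u ∈ headUsers k d then M / k else 0) = truncatedUniform m k (d u) * M := by
          rw [truncatedUniform_mul]
          simp [headUsers]
        rw [h3] at h2
        rw [← div_le_iff₀ hB']
        linarith)
    refine hle.trans (hsum.trans_eq ?_)
    rw [← Finset.sum_mul, Finset.sum_add_distrib]
    simp
  have hw : ∀ d : Demand n m, 0 ≤ ∏ u, q (d u) := fun d => Finset.prod_nonneg fun u _ => hq0 _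
  rw [conditionalRate, div_le_iff₀ hB']
  calc ∑ d : Demand n m, (∏ u, q (d u)) * (N C d : ℝ)
      ≤ ∑ d : Demand n m, (∏ u, q (d u))
          * ((∑ S, colorDensity (M / k) (headUsers k d) S + 2 ^ n * δ) * B) :=
        Finset.sum_le_sum fun d _ => mul_le_mul_of_nonneg_left (hcount d) (hw d)
    _ = (∑ d : Demand n m, (∏ u, q (d u)) * ∑ S, colorDensity (M / k) (headUsers k d) S
          + (∑ d : Demand n m, ∏ u, q (d u)) * (2 ^ n * δ)) * B := by
        rw [Finset.sum_mul, ← Finset.sum_add_distrib, Finset.sum_mul]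
        exact Finset.sum_congr rfl fun d _ => by ring
    _ ≤ (psiTilde n M q k + 2 ^ n * δ) * B := by
        rw [sum_demand_weight hq, one_mul]
        gcongr
        exact sum_demand_sum_colorDensity_le hq0 hq hM hMk

end Rate
end Caching

/-- `n` users, `m` files, cache capacity `M`, demand distribution `q`, cut-off index `k`, and
`B F` packets per file when the file size is `F`. For file size `F`, the greedy constrained
coloring uses `N F C d` colors; all possible ways to make its arbitrary choices are covered. -/
theorem lemma1 (n m k : ℕ) (M : ℝ) (hM : 0 < M) (hMk : M ≤ (k : ℝ)) (hkm : k ≤ m)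
    (q : Fin m → ℝ) (hq_nonneg : ∀ f, 0 ≤ q f) (hq_sum : ∑ f, q f = 1) (hq_anti : Antitone q)
    (B : ℕ → ℕ) (hB : Filter.Tendsto B Filter.atTop Filter.atTop)
    (N : (F : ℕ) → Caching.Placement n m (B F) → Caching.Demand n m → ℕ)
    (hN : ∀ F C d, Caching.IsGCCColorCount C d (N F C d))
    (ε : ℝ) (hε : 0 < ε) :
    Filter.Tendsto
      (fun F : ℕ =>
        Caching.placementLaw n (B F) M (Caching.truncatedUniform m k)
          {C | Caching.conditionalRate q (N F) C
            ≤ min (Caching.psiTilde n M q k) (Caching.mBar n q) + ε})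
      Filter.atTop (nhds 1) := by
  have hk : (0 : ℝ) < k := hM.trans_le hMk
  have hx0 : 0 ≤ M / k := (div_pos hM hk).le
  have hx1 : M / k ≤ 1 := (div_le_one hk).2 hMk
  have hp0 : ∀ f : Fin m, 0 ≤ Caching.truncatedUniform m k f * M := fun f => by
    rw [Caching.truncatedUniform_mul]
    split_ifs <;> simp [hx0]
  have hp1 : ∀ f : Fin m, Caching.truncatedUniform m k f * M ≤ 1 := fun f => by
    rw [Caching.truncatedUniform_mul]
    split_ifs <;> simp [hx1]
  have hprob : ∀ F, IsProbabilityMeasure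
      (Caching.placementLaw n (B F) M (Caching.truncatedUniform m k)) := fun F =>
    Caching.isProbabilityMeasure_placementLaw fun f =>
      Nat.floor_le_of_le (mul_le_of_le_one_left (Nat.cast_nonneg _) (hp1 f))
  -- This tolerance makes the total error over all user sets exactly `ε`.
  have hδ : 0 < ε / 2 ^ n := by positivity
  refine tendsto_of_tendsto_of_tendsto_of_le_of_le'
    (Caching.tendsto_placementLaw_abs_sub_le (n := n) hp0 hp1 hB hδ) tendsto_const_nhds ?_
    (Eventually.of_forall fun F => prob_le_one)
  filter_upwards [hB.eventually_gt_atTop 0] with F hF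
  -- All the randomness of the caches is in the concentration event; on it both bounds hold for
  -- every way of making the choices.
  refine measure_mono fun C hC => ?_
  have h1 := Caching.conditionalRate_le_psiTilde_add hq_nonneg hq_sum hM hMk hF (hN F C) hδ.le hC
  rw [mul_div_cancel₀ _ (by positivity)] at h1
  have h2 := Caching.conditionalRate_le_mBar hq_nonneg hq_sum hF (hN F C)
  rw [Set.mem_ofPred_eq, ← min_add_add_right]
  exact le_min h1 (h2.trans (le_add_of_nonneg_right hε.le))
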